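/- For a metric space $(X,d)$ and an integer $n\ge 0$, a function $D\colon[0,\infty)\to[0,\infty)$ is called an $n$-dimensional control function for $X$ if for every $r>0$ there is a cover $\mathcal U=\mathcal U_1\cup\dots\cup\mathcal U_{n+1}$ of $X$ such that every element of $\mathcal U$ has diameter at most $D(r)$ and each $\mathcal U_i$ is $r$-disjoint, i.e. $d(a,b)\ge r$ whenever $a$ and $b$ belong to different elements of $\mathcal U_i$. The asymptotic Assouad-Nagata dimension $\operatorname{asdim}_{AN}(X)$ is the least $n$ for which $X$ has an $n$-dimensional control function of the form $D(r)=c\cdot r+b$ with constants $b,c\ge 0$, and $\infty$ if there is no such $n$. The linearly controlled asymptotic dimension $\operatorname{l-asdim}(X)$ is the least $n$ for which $X$ has an $n$-dimensional control function $D$ such that, for some $c>0$, $D(r)=c\cdot r$ for all $r$ in some unbounded subset of $[0,\infty)$, and $\infty$ if there is no such $n$. A metric on a group is called proper if all bounded subsets are finite, and invariant if all left and right translations are isometries. **Proposition.** There is an abelian torsion group $G$ with a proper invariant metric $d$ such that $$\operatorname{l-asdim}(G,d)=0\quad\text{and}\quad\operatorname{asdim}_{AN}(G,d)=\infty.$$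 In particular, $\operatorname{l-asdim}(G,d)\ne\operatorname{asdim}_{AN}(G,d)$, so Dranishnikov's question whether $\operatorname{l-asdim}(X)=\operatorname{asdim}_{AN}(X)$ holds for all metric spaces $X$ has a negative answer. -/

import Mathlib

open scoped NNReal

namespace LargeScale

/-- A family of subsets of a metric space is `r`-disjoint if `dist a b ≥ r` for any two points
`a`, `b` belonging to different elements of the family. -/
def RDisjoint {X : Type*} [MetricSpace X] (r : ℝ≥0) (U : Set (Set X)) : Prop :=
  ∀ A ∈ U, ∀ B ∈ U, A ≠ B → ∀ a ∈ A, ∀ b ∈ B, (r : ℝ) ≤ dist a b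

/-- All elements of the family have diameter at most `M`. -/
def FamilyBounded {X : Type*} [MetricSpace X] (M : ℝ≥0) (U : Set (Set X)) : Prop :=
  ∀ A ∈ U, ∀ a ∈ A, ∀ b ∈ A, dist a b ≤ (M : ℝ)

/-- `D` is an `n`-dimensional control function for `X`: for every `r > 0` there is a cover of `X`
that is the union of `n + 1` families, each of them `r`-disjoint, whose elements all have
diameter at most `D r`. -/
def IsControlFunction (X : Type*) [MetricSpace X] (n : ℕ) (D : ℝ≥0 → ℝ≥0) : Prop :=
  ∀ r : ℝ≥0, 0 < r → ∃ U : Fin (n + 1) → Set (Set X),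
    (⋃ i, ⋃₀ U i) = Set.univ ∧ ∀ i, RDisjoint r (U i) ∧ FamilyBounded (D r) (U i)

/-- The asymptotic Assouad-Nagata dimension of `X` is at most `n`: there is an `n`-dimensional
control function of the form `r ↦ c * r + b`. -/
def AsdimANLE (X : Type*) [MetricSpace X] (n : ℕ) : Prop :=
  ∃ D : ℝ≥0 → ℝ≥0, IsControlFunction X n D ∧ ∃ c b : ℝ≥0, ∀ r, D r = c * r + b

/-- The linearly controlled asymptotic dimension of `X` is at most `n`: there is an
`n`-dimensional control function which agrees with some dilation `r ↦ c * r`, `c > 0`, on an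
unbounded subset of the half-line. -/
def LAsdimLE (X : Type*) [MetricSpace X] (n : ℕ) : Prop :=
  ∃ D : ℝ≥0 → ℝ≥0, IsControlFunction X n D ∧
    ∃ c : ℝ≥0, 0 < c ∧ ∃ S : Set ℝ≥0, ¬ BddAbove S ∧ ∀ r ∈ S, D r = c * r

/-- The asymptotic Assouad-Nagata dimension: the least `n` with `AsdimANLE X n`,
and `⊤` if there is none. -/
noncomputable def asdimAN (X : Type*) [MetricSpace X] : ℕ∞ :=
  ⨅ (n : ℕ) (_ : AsdimANLE X n), (n : ℕ∞)

/-- The linearly controlled asymptotic dimension: the least `n` with `LAsdimLE X n`,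
and `⊤` if there is none. -/
noncomputable def lAsdim (X : Type*) [MetricSpace X] : ℕ∞ :=
  ⨅ (n : ℕ) (_ : LAsdimLE X n), (n : ℕ∞)

/-- The metric of a (discrete) group is proper if all bounded subsets are finite. -/
def IsProperMetric (G : Type*) [MetricSpace G] : Prop :=
  ∀ s : Set G, Bornology.IsBounded s → s.Finite

/-- The metric of a group is invariant if all left and all right translations are isometries. -/
def IsInvariantMetric (G : Type*) [AddGroup G] [MetricSpace G] : Prop :=
  ∀ g x y : G, dist (g + x) (g + y) = dist x y ∧ dist (x + g) (y + g) = dist x y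

end LargeScale

/-! ### Double counting in Hamming cubes. -/

namespace LargeScale

open Finset

/-! Let `G` be the sum of the groups `(ℤ/2)^k`, each coordinate of the `k`-th one weighing `k!`. The
summands up to `k` weigh `(k+1)! - 1` in total, so their sum is a subgroup whose cosets are
`(k+1)!`-disjoint and of smaller diameter: the control is linear at factorial scales
(`lAsdimLE_zero`). The `k`-th summand is a Hamming cube scaled by `k!`. Linear control at scale `3 *
k!` would give covers of all these cubes by `n + 1` families, 3-disjoint and bounded independently
of `k`. Counting edges rules this out for large `k` (`card_le_of_cover_hammingCube`). -/

/-- Given a family of points of the Hamming cube and a base point `β S` for each of them, at distance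
at most `C` and locally constant, counting the edges that lead away from the base points bounds the
size of the family. -/
theorem card_mul_le_of_locallyConstant_base {ι : Type*} [Fintype ι] [DecidableEq ι] (C : ℕ)
    (X : Finset (Finset ι)) (β : Finset ι → Finset ι)
    (hC : ∀ S ∈ X, #(symmDiff S (β S)) ≤ C)
    (hβ : ∀ S ∈ X, ∀ T ∈ X, #(symmDiff S T) ≤ 2 → β S = β T) :
    #X * (Fintype.card ι - C) ≤ 2 ^ Fintype.card ι * (C + 1) := by
  classical
  let R : Finset ι → Finset ι → Prop :=
    fun S T => ∃ j, j ∉ symmDiff S (β S) ∧ T = symmDiff S {j}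
  have key := Finset.card_mul_le_card_mul (s := X) (t := (univ : Finset (Finset ι))) R
    (m := Fintype.card ι - C) (n := C + 1) ?_ ?_
  · simpa [Finset.card_univ, Fintype.card_finset] using key
  · intro S hS
    have h1 : Fintype.card ι - C ≤ #(symmDiff S (β S))ᶜ := by
      rw [card_compl]
      exact Nat.sub_le_sub_left (hC S hS) _
    refine h1.trans (card_le_card_of_injOn (fun j => symmDiff S {j}) ?_ ?_)
    · intro j hj
      simp only [coe_compl, Set.mem_compl_iff, mem_coe] at hj
      simp only [bipartiteAbove, mem_coe, mem_filter, mem_univ, true_and]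
      exact ⟨j, hj, rfl⟩
    · intro i _ j _ hij
      exact singleton_injective (symmDiff_right_injective S hij)
  · intro T _
    rcases (bipartiteBelow R X T).eq_empty_or_nonempty with h0 | ⟨S₀, hS₀⟩
    · simp [h0]
    · obtain ⟨hS₀X, j₀, hj₀, hT₀⟩ := mem_filter.1 hS₀
      -- Two neighbours of `T` differ in at most two coordinates, so they share a base point. Each
      -- is `T` with a coordinate of `symmDiff T (β S₀)` flipped, which leaves at most `C + 1` of
      -- them.
      have hbase : ∀ S ∈ X, ∀ j, T = symmDiff S {j} → β S = β S₀ := by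
        intro S hS j hT
        refine hβ S hS S₀ hS₀X ?_
        have h1 : symmDiff S S₀ = symmDiff {j} {j₀} := by
          have hS' : S = symmDiff T {j} := by rw [hT, symmDiff_symmDiff_cancel_right]
          have hS₀' : S₀ = symmDiff T {j₀} := by rw [hT₀, symmDiff_symmDiff_cancel_right]
          rw [hS', hS₀', symmDiff_comm T {j}, symmDiff_assoc, symmDiff_symmDiff_cancel_left]
        rw [h1]
        exact (card_le_card (symmDiff_le_sup (a := ({j} : Finset ι)) (b := {j₀}))).trans
          ((card_union_le _ _).trans (by simp))
      have hflip : ∀ S (j : ι), j ∉ symmDiff S (β S₀) →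
          symmDiff (symmDiff S {j}) (β S₀) = insert j (symmDiff S (β S₀)) := by
        intro S j hj
        rw [symmDiff_comm S {j}, symmDiff_assoc]
        ext a
        simp only [mem_symmDiff, mem_singleton, mem_insert] at hj ⊢
        by_cases ha : a = j
        · subst ha; tauto
        · tauto
      have hle : #(symmDiff T (β S₀)) ≤ C + 1 := by
        rw [hT₀, hflip S₀ j₀ hj₀]
        exact (card_insert_le _ _).trans (Nat.succ_le_succ (hC S₀ hS₀X))
      have hsub : bipartiteBelow R X T ⊆ (symmDiff T (β S₀)).image (fun j => symmDiff T {j}) := by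
        intro S hS
        obtain ⟨hSX, j, hj, hT⟩ := mem_filter.1 hS
        rw [hbase S hSX j hT] at hj
        refine mem_image.2 ⟨j, ?_, ?_⟩
        · rw [hT, hflip S j hj]
          exact mem_insert_self _ _
        · rw [hT, symmDiff_symmDiff_cancel_right]
      exact (card_le_card hsub).trans (card_image_le.trans hle)

/-- A Hamming cube of large dimension has no cover by few families that are `3`-disjoint and
uniformly bounded. -/
theorem card_le_of_cover_hammingCube {ι : Type*} [Fintype ι] [DecidableEq ι] (n C : ℕ)
    (U : Fin n → Set (Set (Finset ι))) (hU : ∀ S, ∃ i, ∃ A ∈ U i, S ∈ A)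
    (hdis : ∀ i, ∀ A ∈ U i, ∀ B ∈ U i, ∀ S ∈ A, ∀ T ∈ B, #(symmDiff S T) ≤ 2 → A = B)
    (hbdd : ∀ i, ∀ A ∈ U i, ∀ S ∈ A, ∀ T ∈ A, #(symmDiff S T) ≤ C) :
    Fintype.card ι - C ≤ n * (C + 1) := by
  classical
  let X : Fin n → Finset (Finset ι) := fun i => univ.filter fun S => ∃ A ∈ U i, S ∈ A
  have hX : ∀ i, #(X i) * (Fintype.card ι - C) ≤ 2 ^ Fintype.card ι * (C + 1) := by
    intro i
    have hex : ∀ S, ∃ A, S ∈ X i → A ∈ U i ∧ S ∈ A := by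
      intro S
      by_cases hS : S ∈ X i
      · obtain ⟨A, hA⟩ := (mem_filter.1 hS).2
        exact ⟨A, fun _ => hA⟩
      · exact ⟨∅, fun h => absurd h hS⟩
    choose M hM using hex
    -- The base point depends only on the set `A`, hence is constant along short steps inside one
    -- family.
    let p : Set (Finset ι) → Finset ι := fun A => if h : A.Nonempty then h.some else ∅
    have hp : ∀ S ∈ X i, p (M S) ∈ M S := by
      intro S hS
      have hne : (M S).Nonempty := ⟨S, (hM S hS).2⟩
      simp only [p, dif_pos hne]
      exact hne.some_mem
    refine card_mul_le_of_locallyConstant_base C (X i) (fun S => p (M S)) ?_ ?_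
    · intro S hS
      exact hbdd i _ (hM S hS).1 S (hM S hS).2 _ (hp S hS)
    · intro S hS T hT hST
      exact congrArg p (hdis i _ (hM S hS).1 _ (hM T hT).1 S (hM S hS).2 T (hM T hT).2 hST)
  have hcov : 2 ^ Fintype.card ι ≤ ∑ i, #(X i) := by
    rw [← Fintype.card_finset, ← card_univ]
    refine (card_le_card ?_).trans (card_biUnion_le (s := univ) (t := X))
    intro S _
    obtain ⟨i, hi⟩ := hU S
    exact mem_biUnion.2 ⟨i, mem_univ _, mem_filter.2 ⟨mem_univ _, hi⟩⟩
  have hsum : 2 ^ Fintype.card ι * (Fintype.card ι - C) ≤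
      2 ^ Fintype.card ι * (n * (C + 1)) := by
    calc 2 ^ Fintype.card ι * (Fintype.card ι - C)
        ≤ (∑ i, #(X i)) * (Fintype.card ι - C) := Nat.mul_le_mul_right _ hcov
      _ = ∑ i, #(X i) * (Fintype.card ι - C) := sum_mul _ _ _
      _ ≤ ∑ _i : Fin n, 2 ^ Fintype.card ι * (C + 1) := sum_le_sum fun i _ => hX i
      _ = 2 ^ Fintype.card ι * (n * (C + 1)) := by simp; ring
  exact Nat.le_of_mul_le_mul_left hsum (by positivity)

/-! ### The weighted direct sum. -/

/-- The direct sum of the groups `(ℤ/2)^k`, `k ∈ ℕ`. -/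
def CubeSum : Type := (Σ k : ℕ, Fin k) →₀ ZMod 2

namespace CubeSum

noncomputable instance : AddCommGroup CubeSum :=
  inferInstanceAs (AddCommGroup ((Σ k : ℕ, Fin k) →₀ ZMod 2))

/-- The coordinates of an element. -/
def coord (x : CubeSum) (p : Σ k : ℕ, Fin k) : ZMod 2 :=
  (show (Σ k : ℕ, Fin k) →₀ ZMod 2 from x) p

/-- The set of nonzero coordinates. -/
def supp (x : CubeSum) : Finset (Σ k : ℕ, Fin k) := Finsupp.support x

theorem mem_supp {x : CubeSum} {p : Σ k : ℕ, Fin k} : p ∈ supp x ↔ coord x p ≠ 0 :=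
  Finsupp.mem_support_iff

theorem coord_sub (x y : CubeSum) (p : Σ k : ℕ, Fin k) :
    coord (x - y) p = coord x p - coord y p :=
  Finsupp.sub_apply x y p

theorem supp_zero : supp 0 = ∅ := Finsupp.support_zero

theorem supp_neg (x : CubeSum) : supp (-x) = supp x := Finsupp.support_neg x

theorem supp_add_subset (x y : CubeSum) : supp (x + y) ⊆ supp x ∪ supp y := Finsupp.support_add

theorem supp_injective : Function.Injective supp := by
  intro x y h
  refine Finsupp.ext fun p => ?_
  have h2 : ∀ a b : ZMod 2, (a ≠ 0 ↔ b ≠ 0) → a = b := by decide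
  exact h2 (coord x p) (coord y p) (by rw [← mem_supp, ← mem_supp, h])

/-- The Hamming weight in which each coordinate of the summand `(ℤ/2)^k` counts `k!`. -/
def weight (x : CubeSum) : ℕ := ∑ p ∈ supp x, p.1.factorial

theorem weight_add_le (x y : CubeSum) : weight (x + y) ≤ weight x + weight y := by
  unfold weight
  calc ∑ p ∈ supp (x + y), p.1.factorial ≤ ∑ p ∈ supp x ∪ supp y, p.1.factorial :=
        sum_le_sum_of_subset (supp_add_subset x y)
    _ ≤ _ := by
        rw [← sum_union_inter]
        exact Nat.le_add_right _ _

theorem factorial_le_weight {x : CubeSum} {p : Σ k : ℕ, Fin k} (hp : p ∈ supp x) :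
    p.1.factorial ≤ weight x :=
  single_le_sum (f := fun p : Σ k : ℕ, Fin k => p.1.factorial) (fun _ _ => Nat.zero_le _) hp

theorem eq_zero_of_weight_eq_zero {x : CubeSum} (h : weight x = 0) : x = 0 := by
  refine supp_injective (supp_zero ▸ eq_empty_of_forall_notMem fun p hp => ?_)
  exact (Nat.factorial_pos p.1).not_ge (h ▸ factorial_le_weight hp)

/-- The weight as a group norm. -/
def groupNorm : AddGroupNorm CubeSum where
  toFun x := weight x
  map_zero' := by simp [weight, supp_zero]
  add_le' x y := by exact_mod_cast weight_add_le x y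
  neg' x := by simp [weight, supp_neg]
  eq_zero_of_map_eq_zero' x h := eq_zero_of_weight_eq_zero (by exact_mod_cast h)

noncomputable instance : NormedAddCommGroup CubeSum := groupNorm.toNormedAddCommGroup

theorem dist_eq_weight (x y : CubeSum) : dist x y = weight (x - y) := by
  rw [dist_eq_norm]
  rfl

theorem isAddTorsion : IsAddTorsion CubeSum := by
  intro x
  refine isOfFinAddOrder_iff_nsmul_eq_zero.2 ⟨2, two_pos, ?_⟩
  refine Finsupp.ext fun p => ?_
  have h2 : ∀ a : ZMod 2, 2 • a = 0 := by decide
  exact h2 _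

theorem isInvariantMetric : IsInvariantMetric CubeSum :=
  fun g x y => ⟨dist_add_left g x y, dist_add_right x y g⟩

/-- The coordinates of the summands `(ℤ/2)^j`, `j ≤ k`. -/
def lowerIndices (k : ℕ) : Finset (Σ k : ℕ, Fin k) := (range (k + 1)).sigma fun _ => univ

theorem mem_lowerIndices {k : ℕ} {p : Σ k : ℕ, Fin k} : p ∈ lowerIndices k ↔ p.1 ≤ k := by
  simp [lowerIndices]

/-- Summand `j` has `j` coordinates of weight `j!`, and `∑ j * j!` over `j ≤ k` telescopes to
`(k+1)! - 1`. -/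
theorem sum_lowerIndices_lt (k : ℕ) :
    ∑ p ∈ lowerIndices k, p.1.factorial < (k + 1).factorial := by
  unfold lowerIndices
  rw [sum_sigma]
  simp only [sum_const, card_univ, Fintype.card_fin, smul_eq_mul]
  induction k with
  | zero => simp
  | succ k ih =>
    rw [sum_range_succ, Nat.factorial_succ (k + 1)]
    nlinarith

/-- The open ball of radius `(k+1)!` about zero is thus a subgroup, as in an ultrametric group. -/
theorem weight_lt_factorial_iff {x : CubeSum} {k : ℕ} :
    weight x < (k + 1).factorial ↔ supp x ⊆ lowerIndices k := by
  constructor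
  · intro h p hp
    rw [mem_lowerIndices]
    by_contra! hk
    exact (((Nat.factorial_le (Nat.succ_le_of_lt hk)).trans (factorial_le_weight hp)).trans_lt
      h).false
  · intro h
    exact (sum_le_sum_of_subset h).trans_lt (sum_lowerIndices_lt k)

theorem isProperMetric : IsProperMetric CubeSum := by
  intro s hs
  obtain ⟨R, hR⟩ := hs.subset_closedBall 0
  refine Set.Finite.of_finite_image (f := supp) ?_ supp_injective.injOn
  refine (finite_toSet (lowerIndices ⌈R⌉₊).powerset).subset ?_
  rintro _ ⟨x, hx, rfl⟩
  have h1 : (weight x : ℝ) ≤ R := by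
    have := hR hx
    rwa [Metric.mem_closedBall, dist_eq_weight, sub_zero] at this
  have h2 : weight x ≤ ⌈R⌉₊ := by exact_mod_cast h1.trans (Nat.le_ceil R)
  rw [mem_coe, mem_powerset]
  exact weight_lt_factorial_iff.1 ((Nat.lt_succ_of_le h2).trans_le (Nat.self_le_factorial _))

/-! ### Linear control at factorial scales. -/

/-- The partition of the group into cosets of the sum of the summands `(ℤ/2)^j`, `j ≤ k`. -/
def cosets (k : ℕ) : Set (Set CubeSum) :=
  Set.range fun x => {y | supp (y - x) ⊆ lowerIndices k}

theorem supp_sub_subset {x y z : CubeSum} {s : Finset (Σ k : ℕ, Fin k)}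
    (h₁ : supp (x - y) ⊆ s) (h₂ : supp (y - z) ⊆ s) : supp (x - z) ⊆ s := by
  rw [← sub_add_sub_cancel x y z]
  exact (supp_add_subset _ _).trans (union_subset h₁ h₂)

theorem supp_sub_comm (x y : CubeSum) : supp (x - y) = supp (y - x) := by
  rw [← neg_sub, supp_neg]

theorem sUnion_cosets (k : ℕ) : ⋃₀ cosets k = Set.univ := by
  refine Set.eq_univ_of_forall fun x => ⟨_, ⟨x, rfl⟩, ?_⟩
  simp [supp_zero]

theorem rDisjoint_cosets (k : ℕ) {r : ℝ≥0} (hr : r ≤ (k + 1).factorial) :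
    RDisjoint r (cosets k) := by
  rintro _ ⟨x, rfl⟩ _ ⟨y, rfl⟩ hne a ha b hb
  refine (NNReal.coe_le_coe.2 hr).trans ?_
  by_contra! hlt
  rw [dist_eq_weight, NNReal.coe_natCast, Nat.cast_lt, weight_lt_factorial_iff] at hlt
  have hxy : supp (x - y) ⊆ lowerIndices k :=
    supp_sub_subset (supp_sub_comm a x ▸ ha) (supp_sub_subset hlt hb)
  refine hne (Set.ext fun z => ⟨fun hz => supp_sub_subset hz hxy, fun hz => ?_⟩)
  exact supp_sub_subset hz (supp_sub_comm x y ▸ hxy)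

theorem familyBounded_cosets (k : ℕ) : FamilyBounded (k + 1).factorial (cosets k) := by
  rintro _ ⟨x, rfl⟩ a ha b hb
  rw [dist_eq_weight, NNReal.coe_natCast, Nat.cast_le]
  exact (weight_lt_factorial_iff.2 (supp_sub_subset ha (supp_sub_comm b x ▸ hb))).le

theorem lAsdimLE_zero : LAsdimLE CubeSum 0 := by
  -- Only at factorial scales must `k` be exact; at other scales any large `k` will do.
  have hex : ∀ r : ℝ≥0, ∃ k : ℕ, r ≤ (k + 1).factorial ∧
      ((∃ j : ℕ, r = (j + 1).factorial) → r = (k + 1).factorial) := by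
    intro r
    by_cases h : ∃ j : ℕ, r = (j + 1).factorial
    · obtain ⟨j, hj⟩ := h
      exact ⟨j, hj.le, fun _ => hj⟩
    · refine ⟨⌈r⌉₊, (Nat.le_ceil r).trans ?_, fun h' => absurd h' h⟩
      exact_mod_cast (Nat.le_succ _).trans (Nat.self_le_factorial _)
  choose κ hκ hκ' using hex
  refine ⟨fun r => (κ r + 1).factorial, fun r _ => ⟨fun _ => cosets (κ r), ?_, fun _ =>
    ⟨rDisjoint_cosets _ (hκ r), familyBounded_cosets _⟩⟩, 1, one_pos,
    Set.range fun j : ℕ => ((j + 1).factorial : ℝ≥0), ?_, ?_⟩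
  · rw [Set.iUnion_const, sUnion_cosets]
  · rintro ⟨M, hM⟩
    obtain ⟨j, hj⟩ := exists_nat_gt M
    refine (hj.trans_le ?_).not_ge (hM ⟨j, rfl⟩)
    exact Nat.cast_le.2 ((Nat.le_succ j).trans (Nat.self_le_factorial _))
  · rintro r ⟨j, rfl⟩
    rw [one_mul]
    exact (hκ' _ ⟨j, rfl⟩).symm

/-! ### Embedded cubes and failure of linear control. -/

/-- The points of the summand `(ℤ/2)^k`, as subsets of `Fin k`. -/
noncomputable def cube (k : ℕ) (S : Finset (Fin k)) : CubeSum :=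
  Finsupp.indicator (S.map (Function.Embedding.sigmaMk (β := Fin) k)) fun _ _ => 1

theorem coord_cube (k : ℕ) (S : Finset (Fin k)) (p : Σ k : ℕ, Fin k) :
    coord (cube k S) p = if p ∈ S.map (Function.Embedding.sigmaMk (β := Fin) k) then 1 else 0 := by
  classical
  exact (Finsupp.indicator_apply _ _ p).trans (by split_ifs <;> rfl)

theorem supp_cube_sub (k : ℕ) (S T : Finset (Fin k)) :
    supp (cube k S - cube k T) =
      (symmDiff S T).map (Function.Embedding.sigmaMk (β := Fin) k) := by
  classical
  ext p
  rw [mem_supp, coord_sub, coord_cube, coord_cube, map_eq_image _ (symmDiff S T),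
    image_symmDiff _ _ (Function.Embedding.injective _), ← map_eq_image, ← map_eq_image, mem_symmDiff]
  split_ifs <;> simp_all

theorem dist_cube (k : ℕ) (S T : Finset (Fin k)) :
    dist (cube k S) (cube k T) = #(symmDiff S T) * (k.factorial : ℝ) := by
  rw [dist_eq_weight, weight, supp_cube_sub, sum_map]
  simp

theorem not_asdimANLE (n : ℕ) : ¬ AsdimANLE CubeSum n := by
  rintro ⟨D, hD, c, b, hcb⟩
  obtain ⟨C, hC⟩ := exists_nat_ge (3 * c + b)
  -- Least `k` with `k - C > (n + 1) * (C + 1)`.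
  obtain ⟨k, hk⟩ : ∃ k : ℕ, k = (n + 1) * (C + 1) + C + 1 := ⟨_, rfl⟩
  have hpos : (0 : ℝ) < k.factorial := by exact_mod_cast k.factorial_pos
  have hone : (1 : ℝ) ≤ k.factorial := by exact_mod_cast k.factorial_pos
  obtain ⟨U, hcov, hU⟩ := hD (3 * k.factorial) (by have := k.factorial_pos; positivity)
  have := card_le_of_cover_hammingCube (ι := Fin k) (n + 1) C
    (fun i => (fun A => cube k ⁻¹' A) '' U i) ?_ ?_ ?_
  · rw [Fintype.card_fin] at this
    omega
  · intro S
    have hS : cube k S ∈ ⋃ i, ⋃₀ U i := hcov ▸ Set.mem_univ _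
    obtain ⟨i, A, hA, hSA⟩ := Set.mem_iUnion.1 hS
    exact ⟨i, _, ⟨A, hA, rfl⟩, hSA⟩
  · rintro i _ ⟨A, hA, rfl⟩ _ ⟨B, hB, rfl⟩ S hS T hT hST
    by_contra hne
    have h := (hU i).1 A hA B hB (fun h => hne (h ▸ rfl)) _ hS _ hT
    rw [dist_cube] at h
    push_cast at h
    have h3 : (3 : ℝ) ≤ #(symmDiff S T) := le_of_mul_le_mul_right h hpos
    have h4 : 3 ≤ #(symmDiff S T) := by exact_mod_cast h3
    omega
  · rintro i _ ⟨A, hA, rfl⟩ S hS T hT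
    have h := (hU i).2 A hA _ hS _ hT
    rw [dist_cube, hcb] at h
    push_cast at h
    have hC' : 3 * (c : ℝ) + b ≤ C := by exact_mod_cast hC
    -- Since `k! ≥ 1`, the additive constant is absorbed into the scale, so `C` does not depend on
    -- `k`.
    have hb : (b : ℝ) ≤ b * k.factorial := le_mul_of_one_le_right b.2 hone
    have h1 : (#(symmDiff S T) : ℝ) * k.factorial ≤ C * k.factorial := by
      calc (#(symmDiff S T) : ℝ) * k.factorial ≤ (3 * (c : ℝ) + b) * k.factorial := by linarith
        _ ≤ C * k.factorial := mul_le_mul_of_nonneg_right hC' hpos.le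
    exact_mod_cast le_of_mul_le_mul_right h1 hpos

theorem lAsdim_eq_zero : lAsdim CubeSum = 0 :=
  nonpos_iff_eq_zero.1 (iInf₂_le (0 : ℕ) lAsdimLE_zero)

theorem asdimAN_eq_top : asdimAN CubeSum = ⊤ :=
  iInf₂_eq_top.2 fun n hn => absurd hn (not_asdimANLE n)

end CubeSum

end LargeScale

theorem mainTheorem10 :
    ∃ (G : Type) (_ : AddCommGroup G) (_ : MetricSpace G),
      IsAddTorsion G ∧
      LargeScale.IsProperMetric G ∧
      LargeScale.IsInvariantMetric G ∧
      LargeScale.lAsdim G = 0 ∧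
      LargeScale.asdimAN G = ⊤ ∧
      LargeScale.lAsdim G ≠ LargeScale.asdimAN G := by
  refine ⟨LargeScale.CubeSum, inferInstance, inferInstance, LargeScale.CubeSum.isAddTorsion,
    LargeScale.CubeSum.isProperMetric, LargeScale.CubeSum.isInvariantMetric,
    LargeScale.CubeSum.lAsdim_eq_zero, LargeScale.CubeSum.asdimAN_eq_top, ?_⟩
  rw [LargeScale.CubeSum.lAsdim_eq_zero, LargeScale.CubeSum.asdimAN_eq_top]
  exact ENat.zero_ne_top
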